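/- **Setting.** Let $d,p,q\in\mathbb N$, and let $(X_i,Z_i)_{i\ge 0}$ be i.i.d. random vectors in $\mathbb R^d\times\mathbb R^p$, distributed as $(X,Z)$. Let $F_k(\cdot\,|z)$ be the conditional distribution function of the $k$-th component of $X$ given $Z=z$, let $U_z=(F_1(X_1|z),\dots,F_d(X_d|z))$ and $U=U_Z$, and let $U_i=(F_1(X_{i,1}|Z_i),\dots,F_d(X_{i,d}|Z_i))$. Let $\Theta\subset\mathbb R^q$ be compact and such that, for some constants $K$ and $\eta>0$, any two points $\theta,\theta'\in\Theta$ with $|\theta-\theta'|<\eta$ are joined inside $\Theta$ by a path $\gamma:[0,1]\to\Theta$ with $|\gamma(s)-\gamma(t)|\le K|\theta-\theta'|\,|s-t|$ (for instance, $\Theta$ convex). For each $\theta\in\Theta$ let $c_\theta$ be a copula density that is continuous and strictly positive on $(0,1)^d$. Let $\mathcal B\subset\mathbb R^p$ be compact, $\beta_0\in\mathcal B$, and let $\psi:\mathbb R^p\times\mathbb R\to\mathbb R^q$ be such that $\psi(\beta,\cdot)$ is measurable for every $\beta\in\mathcal B$. Single-index model: for almost every $z$ (with respect to the law of $Z$),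 $\psi(\beta_0,\beta_0'z)\in\Theta$, and conditionally on $Z=z$ the vector $U_z$ has density $c_{\psi(\beta_0,\beta_0'z)}$ on $(0,1)^d$. **Trimming.** Let $\mathcal Z=[-M_z,M_z]^p$ with $\mathbb P(Z\in\mathcal Z)>0$, let $\nu_n\in(0,1/2)$ with $\nu_n\to0$, and let $\mathcal E_n=[\nu_n,1-\nu_n]^d$. Suppose that $\psi(\beta,\beta'z)\in\Theta$ for all $\beta\in\mathcal B$ and $z\in\mathcal Z$. **Identification and envelope.** The function $M(\beta)=E[\ln c_{\psi(\beta,\beta'Z)}(U)\mid Z\in\mathcal Z]$ is continuous on $\mathcal B$ and uniquely maximized over $\mathcal B$ at $\beta_0$. Almost surely on $\{Z\in\mathcal Z\}$, the map $\beta\mapsto\ln c_{\psi(\beta,\beta'Z)}(U)$ is continuous on $\mathcal B$. There are a measurable function $h$ and $\alpha>1$ such that, almost surely on $\{Z\in\mathcal Z\}$, $\sup_{\beta\in\mathcal B}|\ln c_{\psi(\beta,\beta'Z)}(U)|\le h(U,Z)$, and $E[h^\alpha(U,Z)\mathbf 1(Z\in\mathcal Z)]<\infty$. **Preliminary estimators.**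 For every $n$, $\hat\psi=\hat\psi_n$ is a random function with $\hat\psi(\beta,\beta'z)\in\Theta$ for all $\beta\in\mathcal B$ and $z\in\mathcal Z$, and $$\sup_{z\in\mathcal Z}\sup_{\beta\in\mathcal B}|\hat\psi(\beta,\beta'z)-\psi(\beta,\beta'z)|=o_P(1).$$ The pseudo-observations $\hat U_i=\hat U_{n,i}$, $i<n$, are random vectors that almost surely lie in $(0,1)^d$, and there is a deterministic sequence $\delta_n>0$ with $\delta_n=o(\nu_n)$ and, almost surely, $$\limsup_{n\to\infty}\ \sup_{i<n}|\hat U_i-U_i|\,\mathbf 1(Z_i\in\mathcal Z)/\delta_n\le1 .$$ **Moments.** A function $f:(0,1)\to(0,\infty)$ is u-shaped if it is symmetric about $1/2$ and (weakly) decreasing on $(0,1/2]$. For $b\in(0,1)$ put $f_b(u)=f(bu)$ if $u\le1/2$ and $f_b(u)=f(1-b(1-u))$ if $u>1/2$; a u-shaped $f$ is reproducing if for every sufficiently small $b>0$ there is a constant $M_b$ with $f_b<M_bf$ on $(0,1)$. Let $\mathcal R_d$ be the set of functions $u\mapsto\prod_{k=1}^d f_k(u_k)$ on $(0,1)^d$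 with every $f_k$ u-shaped and reproducing. There are $r,\tilde r_1,\dots,\tilde r_d\in\mathcal R_d$ such that, for every $u\in(0,1)^d$, the gradient (within $\Theta$) $\nabla_\theta\ln c_\theta(u)$ and the partial derivatives $\partial_{u_k}\ln c_\theta(u)$ exist for all $\theta\in\Theta$ and satisfy $$\sup_{\theta\in\Theta}|\nabla_\theta\ln c_\theta(u)|\le r(u),\qquad \sup_{\theta\in\Theta}|\partial_{u_k}\ln c_\theta(u)|\le\tilde r_k(u)\quad(k=1,\dots,d),$$ and $E[r(U)\mathbf 1(Z\in\mathcal Z)]<\infty$, $\ E[U_k(1-U_k)\tilde r_k(U)\mathbf 1(Z\in\mathcal Z)]<\infty$ for $k=1,\dots,d$. **Conclusion.** If, for every $n$, almost surely $\hat\beta=\hat\beta_n$ is a maximizer over $\beta\in\mathcal B$ of $$\sum_{i<n}\mathbf 1(\hat U_i\in\mathcal E_n,\ Z_i\in\mathcal Z)\,\ln c_{\hat\psi(\beta,\beta'Z_i)}(\hat U_i),$$ then $\hat\beta_n\to\beta_0$ in probability as $n\to\infty$. -/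

import Mathlib

open MeasureTheory ProbabilityTheory Filter Set
open scoped Topology ENNReal

noncomputable section

namespace SingleIndexCopula

/-- `ℝⁿ` with the Euclidean norm. -/
abbrev Vec (n : ℕ) : Type := EuclideanSpace ℝ (Fin n)

/-- The open unit cube `(0,1)^d`. -/
def openCube (d : ℕ) : Set (Vec d) := {u | ∀ k, u k ∈ Ioo (0 : ℝ) 1}

/-- The trimming set `[ν, 1 - ν]^d`. -/
def trimCube (d : ℕ) (ν : ℝ) : Set (Vec d) := {u | ∀ k, u k ∈ Icc ν (1 - ν)}

/-- The covariate window `[-Mz, Mz]^p`. -/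
def covBox (p : ℕ) (Mz : ℝ) : Set (Vec p) := {z | ∀ j, z j ∈ Icc (-Mz) Mz}

open Classical in
/-- The trimming function `𝟏(u ∈ [ν, 1 - ν]^d, z ∈ [-Mz, Mz]^p)`. -/
def trim {d p : ℕ} (ν Mz : ℝ) (u : Vec d) (z : Vec p) : ℝ :=
  if u ∈ trimCube d ν ∧ z ∈ covBox p Mz then 1 else 0

/-! ### Conditional margins, conditional copulas -/

/-- The conditional law of `X` given `Z = z`, when `μ` is the law of `(X, Z)`. -/
def condLaw {d p : ℕ} (μ : Measure (Vec d × Vec p)) [IsFiniteMeasure μ] (z : Vec p) :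
    Measure (Vec d) :=
  condDistrib Prod.fst Prod.snd μ z

/-- The conditional marginal distribution function `F_k(x | z)`. -/
def condMarginalCDF {d p : ℕ} (μ : Measure (Vec d × Vec p)) [IsFiniteMeasure μ]
    (k : Fin d) (z : Vec p) (x : ℝ) : ℝ :=
  cdf ((condLaw μ z).map (fun v => v k)) x

/-- The vector `U_z = (F_1(x_1 | z), …, F_d(x_d | z))` attached to `w = (x, z)`. -/
def condPIT {d p : ℕ} (μ : Measure (Vec d × Vec p)) [IsFiniteMeasure μ]
    (w : Vec d × Vec p) : Vec d :=
  WithLp.toLp 2 (fun k => condMarginalCDF μ k w.2 (w.1 k))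

/-- The measure on `(0,1)^d` with Lebesgue density `f`. -/
def densityMeasure {d : ℕ} (f : Vec d → ℝ) : Measure (Vec d) :=
  (volume.restrict (openCube d)).withDensity (fun u => ENNReal.ofReal (f u))

/-- `f` is a continuous copula density: a continuous probability density on `(0,1)^d` all of
whose one-dimensional margins are uniform on `(0,1)`. -/
structure IsCopulaDensity {d : ℕ} (f : Vec d → ℝ) : Prop where
  nonneg : ∀ u ∈ openCube d, 0 ≤ f u
  continuousOn : ContinuousOn f (openCube d)
  isProb : IsProbabilityMeasure (densityMeasure f)
  margins : ∀ k : Fin d,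
    (densityMeasure f).map (fun u => u k) = volume.restrict (Ioo (0 : ℝ) 1)

/-! ### Reproducing u-shaped functions -/

/-- `f : (0,1) → (0,∞)` is symmetric about `1/2` and decreasing on `(0, 1/2]`. -/
structure IsUShaped (f : ℝ → ℝ) : Prop where
  pos : ∀ u ∈ Ioo (0 : ℝ) 1, 0 < f u
  symm : ∀ u ∈ Ioo (0 : ℝ) 1, f (1 - u) = f u
  anti : AntitoneOn f (Ioc 0 (1 / 2))

/-- The function `r_b` attached to `r` and `b ∈ (0,1)`. -/
def dilate (b : ℝ) (r : ℝ → ℝ) (u : ℝ) : ℝ :=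
  if u ≤ 1 / 2 then r (b * u) else r (1 - b * (1 - u))

/-- The class `𝓡` of reproducing u-shaped functions. -/
structure IsReproducing (r : ℝ → ℝ) : Prop where
  uShaped : IsUShaped r
  reproducing : ∀ᶠ b in 𝓝[>] (0 : ℝ), ∃ M : ℝ, ∀ u ∈ Ioo (0 : ℝ) 1, dilate b r u < M * r u

/-- The class `𝓡_d` of products of `d` reproducing u-shaped functions. -/
def IsReproducingProd {d : ℕ} (r : Vec d → ℝ) : Prop :=
  ∃ ρ : Fin d → ℝ → ℝ, (∀ k, IsReproducing (ρ k)) ∧ ∀ u ∈ openCube d, r u = ∏ k, ρ k (u k)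

/-! ### Parameter set, criterion -/

/-- Nearby points of `T` are joined inside `T` by paths whose length is at most a constant
times their distance. Convex sets have this property, with `K = 1` and straight paths. -/
def LocallyQuasiconvex {q : ℕ} (T : Set (Vec q)) : Prop :=
  ∃ K η : ℝ, 0 < η ∧ ∀ θ ∈ T, ∀ θ' ∈ T, ‖θ - θ'‖ < η →
    ∃ γ : ℝ → Vec q, γ 0 = θ ∧ γ 1 = θ' ∧ (∀ t ∈ Icc (0 : ℝ) 1, γ t ∈ T) ∧
      ∀ s ∈ Icc (0 : ℝ) 1, ∀ t ∈ Icc (0 : ℝ) 1, ‖γ s - γ t‖ ≤ K * ‖θ - θ'‖ * |s - t|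

/-- The trimmed pseudo-log-likelihood
`b ↦ ∑_{i < n} 𝟏(u_i ∈ [ν, 1 - ν]^d, z_i ∈ [-Mz, Mz]^p) ln c_{φ(b, b'z_i)}(u_i)`. -/
def criterion {d p q n : ℕ} (c : Vec q → Vec d → ℝ) (ν Mz : ℝ) (φ : Vec p → ℝ → Vec q)
    (u : Fin n → Vec d) (z : Fin n → Vec p) (b : Vec p) : ℝ :=
  ∑ i, trim ν Mz (u i) (z i) * Real.log (c (φ b (inner ℝ b (z i))) (u i))

/-- The limiting criterion `M(b) = E[ln c_{ψ(b, b'Z)}(U_Z) | Z ∈ [-Mz, Mz]^p]`. -/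
def limitCriterion {d p q : ℕ} (μ : Measure (Vec d × Vec p)) [IsFiniteMeasure μ]
    (c : Vec q → Vec d → ℝ) (Mz : ℝ) (ψ : Vec p → ℝ → Vec q) (b : Vec p) : ℝ :=
  ∫ w, Real.log (c (ψ b (inner ℝ b w.2)) (condPIT μ w)) ∂(μ[|{w | w.2 ∈ covBox p Mz}])

end SingleIndexCopula

end

/-!
The proof is Wald's consistency argument for M-estimators, applied to a criterion that is only
approximately an average of i.i.d. terms.

*Oracle criterion.* Replacing the pseudo-observations by the exact `U_i`, the estimated link by `ψ`
and dropping the trimming of `U` gives an average of the i.i.d. terms `oracleTerm`. They are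
continuous in `β ∈ B` and dominated by an integrable envelope. Hence every `b ≠ β₀` in `B` has a
neighbourhood on which they lie below one integrable function of mean smaller than the mean of the
term at `β₀` (`exists_integrable_local_bound`). Compactness and the law of large numbers yield
`exists_highProb_average_add_le`: with probability tending to one, the oracle criterion at `β₀`
exceeds, by a fixed margin, its values at distance at least `ε` from `β₀`.

*Remainder.* The feasible criterion differs from the oracle one by `o_P(1)`, uniformly over `B`
(`highProb_abs_criterion_sub_oracle_le`). The summandwise bound is `exists_abs_trimmed_log_sub_le`.
On the trimming set, `δ_n = o(ν_n)` makes the distances of `U_i` and of its pseudo-observation to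
the boundary of the cube comparable, so reproducing functions at the pseudo-observation, and at
every point between the two, are bounded by a constant times their value at `U_i`. Therefore
* changing the link function costs at most a constant times `‖ψhat - ψ‖ r(U_i)`, by the mean value
  inequality along a Lipschitz path in `Θ`;
* changing the observation costs at most a constant times
  `(δ_n / ν_n) ∑_k U_ik (1 - U_ik) rt_k(U_i)`, by the mean value theorem in each coordinate and
  `U_ik (1 - U_ik) ≥ ν_n / 4`;
* trimming costs at most the envelope on the event that `U_i` is close to the boundary of the cube,
  whose mean is small by dominated convergence.

No measurability of `βhat` or `ψhat` is available, so events of probability tending to one are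
handled through the outer measure of their complements (`HighProb`), and almost sure limits are
turned into such events only for measurable quantities.
-/

namespace SingleIndexCopula

/-! ### Reproducing functions and mean value inequalities -/

theorem min_one_sub_mem_Ioc {x : ℝ} (hx : x ∈ Ioo (0 : ℝ) 1) :
    min x (1 - x) ∈ Ioc (0 : ℝ) (1 / 2) := by
  refine ⟨lt_min hx.1 (by linarith [hx.2]), ?_⟩
  rcases le_total x (1 / 2) with h | h
  · exact (min_le_left _ _).trans h
  · exact (min_le_right _ _).trans (by linarith)

theorem IsUShaped.apply_min {f : ℝ → ℝ} (hf : IsUShaped f) {x : ℝ} (hx : x ∈ Ioo (0 : ℝ) 1) :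
    f (min x (1 - x)) = f x := by
  rcases min_choice x (1 - x) with h | h
  · rw [h]
  · rw [h, hf.symm x hx]

theorem IsUShaped.dilate_eq {f : ℝ → ℝ} (hf : IsUShaped f) {b u : ℝ} (hb : b ∈ Ioo (0 : ℝ) 1)
    (hu : u ∈ Ioo (0 : ℝ) 1) : dilate b f u = f (b * min u (1 - u)) := by
  have h2 : b * (1 - u) ∈ Ioo (0 : ℝ) 1 :=
    ⟨mul_pos hb.1 (by linarith [hu.2]), by nlinarith [hb.1, hb.2, hu.1, hu.2]⟩
  unfold dilate
  split_ifs with h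
  · rw [min_eq_left (by linarith)]
  · rw [min_eq_right (by linarith), hf.symm _ h2]

/-- A reproducing function changes by at most a constant factor when the distance of its argument
to the boundary of `(0,1)` is reduced by at most one half. -/
theorem IsReproducing.exists_le_mul {f : ℝ → ℝ} (hf : IsReproducing f) :
    ∃ M : ℝ, 0 ≤ M ∧ ∀ u ∈ Ioo (0 : ℝ) 1, ∀ v ∈ Ioo (0 : ℝ) 1,
      min u (1 - u) ≤ 2 * min v (1 - v) → f v ≤ M * f u := by
  have hsmall : ∀ᶠ b in 𝓝[>] (0 : ℝ), b ∈ Ioo (0 : ℝ) (1 / 2) :=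
    Ioo_mem_nhdsGT (by norm_num)
  obtain ⟨b, ⟨M, hM⟩, hb⟩ := (hf.reproducing.and hsmall).exists
  have hb1 : b ∈ Ioo (0 : ℝ) 1 := ⟨hb.1, by linarith [hb.2]⟩
  have key : ∀ u ∈ Ioo (0 : ℝ) 1, b * min u (1 - u) ∈ Ioc (0 : ℝ) (1 / 2) := fun u hu => by
    have h := min_one_sub_mem_Ioc hu
    exact ⟨mul_pos hb.1 h.1, by nlinarith [h.1, h.2, hb.1, hb.2]⟩
  have hpos : ∀ u ∈ Ioo (0 : ℝ) 1, f (b * min u (1 - u)) < M * f u := fun u hu => by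
    rw [← hf.uShaped.dilate_eq hb1 hu]; exact hM u hu
  refine ⟨M, ?_, fun u hu v hv huv => ?_⟩
  · have h12 : (1 / 2 : ℝ) ∈ Ioo (0 : ℝ) 1 := by constructor <;> norm_num
    have h := key _ h12
    have h1 := hf.uShaped.pos _ ⟨h.1, h.2.trans_lt (by norm_num)⟩
    have h2 := hf.uShaped.pos _ h12
    exact (pos_of_mul_pos_left (h1.trans (hpos _ h12)) h2.le).le
  · have hu' := min_one_sub_mem_Ioc hu
    rw [← hf.uShaped.apply_min hv]
    refine (hf.uShaped.anti (key u hu) (min_one_sub_mem_Ioc hv) ?_).trans (hpos u hu).le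
    nlinarith [hb.2, hu'.1]

theorem IsReproducingProd.nonneg {d : ℕ} {r : Vec d → ℝ} (hr : IsReproducingProd r) {u : Vec d}
    (hu : u ∈ openCube d) : 0 ≤ r u := by
  obtain ⟨ρ, hρ, h⟩ := hr
  rw [h u hu]
  exact Finset.prod_nonneg fun k _ => ((hρ k).uShaped.pos _ (hu k)).le

theorem IsReproducingProd.exists_le_mul {d : ℕ} {r : Vec d → ℝ} (hr : IsReproducingProd r) :
    ∃ M : ℝ, 0 ≤ M ∧ ∀ u ∈ openCube d, ∀ v ∈ openCube d,
      (∀ k, min (u k) (1 - u k) ≤ 2 * min (v k) (1 - v k)) → r v ≤ M * r u := by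
  obtain ⟨ρ, hρ, h⟩ := hr
  choose M hM0 hM using fun k => (hρ k).exists_le_mul
  refine ⟨∏ k, M k, Finset.prod_nonneg fun k _ => hM0 k, fun u hu v hv huv => ?_⟩
  rw [h u hu, h v hv, ← Finset.prod_mul_distrib]
  exact Finset.prod_le_prod (fun k _ => ((hρ k).uShaped.pos _ (hv k)).le)
    fun k _ => hM k _ (hu k) _ (hv k) (huv k)

/-- Mean value inequality along a Lipschitz path that stays in `T`. The path need not be
differentiable: only the local growth of `f ∘ γ` is used. -/
theorem abs_sub_le_of_lipschitz_path {q : ℕ} {T : Set (Vec q)} {f : Vec q → ℝ} {C L : ℝ}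
    (hL : 0 ≤ L)
    (hf : ∀ θ ∈ T, ∃ g : Vec q, HasGradientWithinAt f g T θ ∧ ‖g‖ ≤ C)
    {γ : ℝ → Vec q} (hγT : ∀ t ∈ Icc (0 : ℝ) 1, γ t ∈ T)
    (hγ : ∀ s ∈ Icc (0 : ℝ) 1, ∀ t ∈ Icc (0 : ℝ) 1, ‖γ s - γ t‖ ≤ L * |s - t|) :
    |f (γ 1) - f (γ 0)| ≤ C * L := by
  have hC : 0 ≤ C := by
    obtain ⟨g, -, hg⟩ := hf _ (hγT 0 ⟨le_rfl, zero_le_one⟩)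
    exact (norm_nonneg g).trans hg
  have hγc : ContinuousOn γ (Icc 0 1) := by
    refine LipschitzOnWith.continuousOn (K := L.toNNReal) ?_
    refine LipschitzOnWith.of_dist_le_mul fun s hs t ht => ?_
    rw [dist_eq_norm, Real.dist_eq, Real.coe_toNNReal _ hL]
    exact hγ s hs t ht
  have hfc : ContinuousOn f T := fun θ hθ => by
    obtain ⟨g, hg, -⟩ := hf θ hθ
    exact hg.hasFDerivWithinAt.continuousWithinAt
  have hcomp : ContinuousOn (fun t => f (γ t) - f (γ 0)) (Icc 0 1) :=
    (hfc.comp hγc hγT).sub continuousOn_const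
  have main : ∀ ⦃t⦄, t ∈ Icc (0 : ℝ) 1 → |f (γ t) - f (γ 0)| ≤ C * L * t := by
    refine image_le_of_liminf_slope_right_le_deriv_boundary (B' := fun _ => C * L)
      hcomp.abs (by simp) (by fun_prop) (fun x _ => ?_) fun x hx ρ hρ => ?_
    · simpa using ((hasDerivAt_id x).const_mul (C * L)).hasDerivWithinAt
    · have hxI : x ∈ Icc (0 : ℝ) 1 := Ico_subset_Icc_self hx
      obtain ⟨g, hg, hgC⟩ := hf _ (hγT x hxI)
      have hε : 0 < (ρ - C * L) / (2 * (L + 1)) := div_pos (by linarith) (by linarith)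
      set ε := (ρ - C * L) / (2 * (L + 1)) with hε_def
      have hεL : ε * (L + 1) = (ρ - C * L) / 2 := by rw [hε_def]; field_simp
      have hloc : ∀ᶠ θ in 𝓝[T] (γ x), |f θ - f (γ x)| ≤ (C + ε) * ‖θ - γ x‖ := by
        filter_upwards [(hasGradientWithinAt_iff_isLittleO.1 hg).bound hε] with θ hθ
        rw [Real.norm_eq_abs] at hθ
        have h1 := abs_le.1 hθ
        have h2 := abs_le.1 ((abs_real_inner_le_norm g (θ - γ x)).trans
          (mul_le_mul_of_nonneg_right hgC (norm_nonneg _)))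
        rw [abs_le]
        constructor <;> linarith [h1.1, h1.2, h2.1, h2.2]
      have htend : Tendsto γ (𝓝[>] x) (𝓝[T] (γ x)) := by
        have hIoo : Ioo x 1 ∈ 𝓝[>] x := Ioo_mem_nhdsGT hx.2
        refine tendsto_nhdsWithin_iff.2 ⟨?_, ?_⟩
        · refine ((hγc x hxI).mono_left ?_)
          refine nhdsWithin_le_of_mem (mem_of_superset hIoo fun z hz => ?_)
          exact ⟨hx.1.trans hz.1.le, hz.2.le⟩
        · filter_upwards [hIoo] with z hz using hγT z ⟨hx.1.trans hz.1.le, hz.2.le⟩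
      refine Eventually.frequently ?_
      filter_upwards [htend.eventually hloc, Ioo_mem_nhdsGT hx.2] with z hz hzI
      have hzx : 0 < z - x := by linarith [hzI.1]
      have hγz := hγ z ⟨hx.1.trans hzI.1.le, hzI.2.le⟩ x hxI
      rw [abs_of_pos hzx] at hγz
      have h3 : |f (γ z) - f (γ x)| ≤ (C + ε) * (L * (z - x)) :=
        hz.trans (mul_le_mul_of_nonneg_left hγz (by positivity))
      have h4 : |f (γ z) - f (γ 0)| - |f (γ x) - f (γ 0)| ≤ |f (γ z) - f (γ x)| := by
        have := abs_sub_le (f (γ z)) (f (γ x)) (f (γ 0))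
        linarith
      rw [slope_def_field, div_lt_iff₀ hzx]
      nlinarith
  simpa using main (right_mem_Icc.2 zero_le_one)

/-- Changing the coordinates one at a time. -/
theorem abs_sub_le_sum_partial {d : ℕ} {f : Vec d → ℝ} {u v : Vec d} {L : Fin d → ℝ}
    (hf : ∀ k, ∀ w : Vec d, (∀ j, w j ∈ uIcc (u j) (v j)) → ∃ a : ℝ,
      HasLineDerivAt ℝ f a w (EuclideanSpace.single k 1) ∧ |a| ≤ L k) :
    |f v - f u| ≤ ∑ k, L k * |v k - u k| := by
  classical
  let m : Finset (Fin d) → Vec d := fun S => WithLp.toLp 2 fun k => if k ∈ S then v k else u k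
  have hm : ∀ S j, m S j = if j ∈ S then v j else u j := fun S j => rfl
  have key : ∀ S : Finset (Fin d), |f (m S) - f u| ≤ ∑ k ∈ S, L k * |v k - u k| := by
    intro S
    induction S using Finset.induction_on with
    | empty =>
      have : m ∅ = u := by ext j; simp [hm]
      simp [this]
    | insert k S hk ih =>
      rw [Finset.sum_insert hk]
      refine (abs_sub_le _ (f (m S)) _).trans (add_le_add ?_ ih)
      let g : ℝ → ℝ := fun t => f (m S + t • EuclideanSpace.single k (1 : ℝ))
      have hcoord : ∀ t j, (m S + t • EuclideanSpace.single k (1 : ℝ)) j =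
          if j = k then u k + t else m S j := by
        intro t j
        by_cases hjk : j = k
        · subst hjk; simp [hm, hk]
        · simp [hjk]
      have hg : ∀ t ∈ uIcc 0 (v k - u k), ∃ a, HasDerivAt g a t ∧ |a| ≤ L k := by
        intro t ht
        obtain ⟨a, ha, haL⟩ := hf k (m S + t • EuclideanSpace.single k (1 : ℝ)) (fun j => by
          rw [hcoord]
          split_ifs with hjk
          · subst hjk
            rw [mem_uIcc] at ht ⊢
            rcases ht with h | h
            · left; constructor <;> linarith [h.1, h.2]
            · right; constructor <;> linarith [h.1, h.2]
          · rw [hm]; split_ifs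
            · exact right_mem_uIcc
            · exact left_mem_uIcc)
        refine ⟨a, ?_, haL⟩
        have h1 : HasDerivAt (fun s : ℝ => f (m S + t • EuclideanSpace.single k (1 : ℝ) +
          s • EuclideanSpace.single k (1 : ℝ))) a (t - t) := by
          rw [sub_self]; exact ha
        have h2 := h1.comp_sub_const t t
        refine h2.congr_of_eventuallyEq (Eventually.of_forall fun s => ?_)
        simp only [g]
        congr 1
        rw [add_assoc, ← add_smul]; congr 2; ring
      choose! g' hg' hgL using hg
      have := (convex_uIcc (0 : ℝ) (v k - u k)).norm_image_sub_le_of_norm_hasDerivWithin_le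
        (fun x hx => (hg' x hx).hasDerivWithinAt) hgL left_mem_uIcc right_mem_uIcc
      have e0 : g 0 = f (m S) := by simp [g]
      have e1 : g (v k - u k) = f (m (insert k S)) := by
        simp only [g]; congr 1; ext j
        rw [hcoord, hm, hm]
        by_cases hjk : j = k
        · subst hjk; simp
        · simp [hjk]
      rw [e0, e1, sub_zero] at this
      exact this
  have hu : m Finset.univ = v := by ext j; simp [hm]
  have := key Finset.univ
  rwa [hu] at this

/-! ### Perturbation of the log-density -/

section LogDensity

variable {d q : ℕ} {Θ : Set (Vec q)} {c : Vec q → Vec d → ℝ} {r : Vec d → ℝ}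
  {rt : Fin d → Vec d → ℝ}

theorem exists_abs_log_sub_le_of_param (hΘ : LocallyQuasiconvex Θ)
    (h_grad : ∀ u ∈ openCube d, ∀ θ ∈ Θ, ∃ g : Vec q,
      HasGradientWithinAt (fun t => Real.log (c t u)) g Θ θ ∧ ‖g‖ ≤ r u) :
    ∃ K η : ℝ, 0 ≤ K ∧ 0 < η ∧ ∀ θ ∈ Θ, ∀ θ' ∈ Θ, ‖θ' - θ‖ < η → ∀ u ∈ openCube d,
      |Real.log (c θ' u) - Real.log (c θ u)| ≤ K * ‖θ' - θ‖ * r u := by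
  obtain ⟨K, η, hη, hpath⟩ := hΘ
  refine ⟨|K|, η, abs_nonneg K, hη, fun θ hθ θ' hθ' hlt u hu => ?_⟩
  rw [norm_sub_rev] at hlt ⊢
  obtain ⟨γ, h0, h1, hγT, hγ⟩ := hpath θ hθ θ' hθ' hlt
  have := abs_sub_le_of_lipschitz_path (f := fun t => Real.log (c t u)) (C := r u)
    (L := |K| * ‖θ - θ'‖) (by positivity) (h_grad u hu) hγT
    fun s hs t ht => (hγ s hs t ht).trans (by gcongr; exact le_abs_self K)
  simp only [h0, h1] at this
  linarith

theorem exists_abs_log_sub_le_of_arg (hrt : ∀ k, IsReproducingProd (rt k))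
    (h_partial : ∀ k, ∀ u ∈ openCube d, ∀ θ ∈ Θ, ∃ a : ℝ,
      HasLineDerivAt ℝ (fun v => Real.log (c θ v)) a u (EuclideanSpace.single k 1) ∧
        |a| ≤ rt k u) :
    ∃ M : ℝ, 0 ≤ M ∧ ∀ θ ∈ Θ, ∀ u ∈ openCube d, ∀ v ∈ openCube d,
      (∀ k, min (u k) (1 - u k) ≤ 2 * min (v k) (1 - v k)) →
      |Real.log (c θ v) - Real.log (c θ u)| ≤ M * ∑ k, rt k u * |v k - u k| := by
  choose M hM0 hM using fun k => (hrt k).exists_le_mul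
  refine ⟨∑ k, M k, Finset.sum_nonneg fun k _ => hM0 k, fun θ hθ u hu v hv huv => ?_⟩
  have key := abs_sub_le_sum_partial (f := fun v => Real.log (c θ v)) (u := u) (v := v)
    (L := fun k => M k * rt k u) fun k w hw => by
      have hwc : w ∈ openCube d := fun j =>
        ordConnected_Ioo.uIcc_subset (hu j) (hv j) (hw j)
      obtain ⟨a, ha, haL⟩ := h_partial k w hwc θ hθ
      refine ⟨a, ha, haL.trans (hM k u hu w hwc fun j => ?_)⟩
      have huj := min_one_sub_mem_Ioc (hu j)
      -- the distance to the boundary is concave, so on a segment it is least at an end point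
      have hmin : min (min (u j) (1 - u j)) (min (v j) (1 - v j)) ≤ min (w j) (1 - w j) := by
        rcases mem_uIcc.1 (hw j) with h | h
        · exact le_min ((min_le_left _ _).trans ((min_le_left _ _).trans h.1))
            ((min_le_right _ _).trans ((min_le_right _ _).trans (by linarith [h.2])))
        · exact le_min ((min_le_right _ _).trans ((min_le_left _ _).trans h.1))
            ((min_le_left _ _).trans ((min_le_right _ _).trans (by linarith [h.2])))
      rcases min_choice (min (u j) (1 - u j)) (min (v j) (1 - v j)) with h | h
      · rw [h] at hmin; linarith [huj.1]
      · rw [h] at hmin; linarith [huv j]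
  refine key.trans ?_
  rw [Finset.mul_sum]
  refine Finset.sum_le_sum fun k _ => ?_
  rw [← mul_assoc]
  have h1 : M k ≤ ∑ j, M j := Finset.single_le_sum (fun j _ => hM0 j) (Finset.mem_univ k)
  have h2 := (hrt k).nonneg hu
  gcongr

open Classical in
/-- The effect on one summand of the criterion of replacing the parameter `θ` by `θ'`, the
observation `u` by `v`, and of trimming. The last term accounts for the observations that are
trimmed away; their exact counterparts lie outside the slightly smaller cube `trimCube d ρ`. -/
theorem exists_abs_trimmed_log_sub_le (hΘ : LocallyQuasiconvex Θ) (hr : IsReproducingProd r)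
    (h_grad : ∀ u ∈ openCube d, ∀ θ ∈ Θ, ∃ g : Vec q,
      HasGradientWithinAt (fun t => Real.log (c t u)) g Θ θ ∧ ‖g‖ ≤ r u)
    (hrt : ∀ k, IsReproducingProd (rt k))
    (h_partial : ∀ k, ∀ u ∈ openCube d, ∀ θ ∈ Θ, ∃ a : ℝ,
      HasLineDerivAt ℝ (fun v => Real.log (c θ v)) a u (EuclideanSpace.single k 1) ∧
        |a| ≤ rt k u) :
    ∃ A η : ℝ, 0 ≤ A ∧ 0 < η ∧ ∀ ν ∈ Ioo (0 : ℝ) (1 / 2), ∀ δ : ℝ, 0 < δ → 4 * δ ≤ ν →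
      ∀ ρ, ν + 2 * δ ≤ ρ → ∀ u ∈ openCube d, ∀ v ∈ openCube d, ‖v - u‖ ≤ 2 * δ →
      ∀ θ ∈ Θ, ∀ θ' ∈ Θ, ∀ τ < η, ‖θ' - θ‖ ≤ τ → ∀ b, |Real.log (c θ u)| ≤ b →
      |(if v ∈ trimCube d ν then Real.log (c θ' v) else 0) - Real.log (c θ u)| ≤
        A * τ * r u + A * (δ / ν) * (∑ k, u k * (1 - u k) * rt k u) +
          if u ∈ trimCube d ρ then 0 else b := by
  obtain ⟨K, η, hK, hη, hθbd⟩ := exists_abs_log_sub_le_of_param hΘ h_grad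
  obtain ⟨M, hM, hubd⟩ := exists_abs_log_sub_le_of_arg hrt h_partial
  obtain ⟨R, hR, hrbd⟩ := hr.exists_le_mul
  refine ⟨K * R + 8 * M, η, by positivity, hη, ?_⟩
  intro ν hν δ hδ hδν ρ hρ u hu v hv huv θ hθ θ' hθ' τ hτ hθτ b hb
  have hru := hr.nonneg hu
  have hτ0 : 0 ≤ τ := (norm_nonneg _).trans hθτ
  have hb0 : 0 ≤ b := (abs_nonneg _).trans hb
  have hν0 := hν.1
  have hcoord : ∀ k, |v k - u k| ≤ 2 * δ := fun k =>
    (PiLp.norm_apply_le (v - u) k).trans huv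
  have hsum : 0 ≤ ∑ k, u k * (1 - u k) * rt k u := Finset.sum_nonneg fun k _ =>
    mul_nonneg (mul_nonneg (hu k).1.le (by linarith [(hu k).2])) ((hrt k).nonneg hu)
  have h1 : 0 ≤ (K * R + 8 * M) * τ * r u := by positivity
  have h2 : 0 ≤ (K * R + 8 * M) * (δ / ν) * ∑ k, u k * (1 - u k) * rt k u :=
    mul_nonneg (by positivity) hsum
  by_cases hvt : v ∈ trimCube d ν
  · rw [if_pos hvt]
    have h3 : 0 ≤ if u ∈ trimCube d ρ then 0 else b := by split_ifs <;> [exact le_rfl; exact hb0]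
    have hvν : ∀ k, ν ≤ min (v k) (1 - v k) := fun k =>
      le_min (hvt k).1 (by linarith [(hvt k).2])
    have humin : ∀ k, min (u k) (1 - u k) ≤ 2 * min (v k) (1 - v k) := fun k => by
      have h := abs_le.1 (hcoord k)
      have : min (u k) (1 - u k) ≤ min (v k) (1 - v k) + 2 * δ := by
        rw [← sub_le_iff_le_add]
        exact le_min (by linarith [min_le_left (u k) (1 - u k)])
          (by linarith [min_le_right (u k) (1 - u k)])
      linarith [hvν k]
    have e1 : |Real.log (c θ' v) - Real.log (c θ v)| ≤ (K * R + 8 * M) * τ * r u :=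
      calc _ ≤ K * ‖θ' - θ‖ * r v := hθbd θ hθ θ' hθ' (hθτ.trans_lt hτ) v hv
        _ ≤ K * τ * (R * r u) := by
          have := hr.nonneg hv
          gcongr
          exact hrbd u hu v hv humin
        _ = K * R * τ * r u := by ring
        _ ≤ _ := by gcongr; linarith
    have e2 : |Real.log (c θ v) - Real.log (c θ u)| ≤
        (K * R + 8 * M) * (δ / ν) * ∑ k, u k * (1 - u k) * rt k u :=
      calc _ ≤ M * ∑ k, rt k u * |v k - u k| := hubd θ hθ u hu v hv humin
        _ ≤ M * ∑ k, 8 * (δ / ν) * (u k * (1 - u k) * rt k u) := by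
          refine mul_le_mul_of_nonneg_left (Finset.sum_le_sum fun k _ => ?_) hM
          have hrk := (hrt k).nonneg hu
          -- `u (1 - u) ≥ min u (1 - u) / 2 ≥ ν / 4`, and `|v - u| ≤ 2 δ`
          have hw : ν / 4 ≤ u k * (1 - u k) := by
            have h := abs_le.1 (hcoord k)
            have a1 : ν / 2 ≤ u k := by linarith [(hvt k).1]
            have a2 : ν / 2 ≤ 1 - u k := by linarith [(hvt k).2]
            rcases le_total (u k) (1 / 2) with h | h <;> nlinarith
          have : 2 * δ ≤ 8 * (δ / ν) * (u k * (1 - u k)) :=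
            calc 2 * δ = 8 * (δ / ν) * (ν / 4) := by field_simp; norm_num
              _ ≤ _ := by gcongr
          rw [mul_comm (rt k u), ← mul_assoc]
          gcongr
          exact (hcoord k).trans this
        _ = 8 * M * (δ / ν) * ∑ k, u k * (1 - u k) * rt k u := by
          rw [← Finset.mul_sum]; ring
        _ ≤ _ := by
          have : 0 ≤ K * R := by positivity
          gcongr; linarith
    linarith [abs_sub_le (Real.log (c θ' v)) (Real.log (c θ v)) (Real.log (c θ u))]
  · have hut : u ∉ trimCube d ρ := fun hu' => hvt fun k => by
      have h := abs_le.1 (hcoord k)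
      have h' := hu' k
      exact ⟨by linarith [h'.1], by linarith [h'.2]⟩
    rw [if_neg hvt, if_neg hut, zero_sub, abs_neg]
    linarith

end LogDensity

/-! ### Events of probability tending to one -/

/-- The event `E n` has probability tending to one. The set `{ω | ¬ E n ω}` need not be measurable:
its outer measure is used. -/
def HighProb {Ω : Type*} [MeasurableSpace Ω] (P : Measure Ω) (E : ℕ → Ω → Prop) : Prop :=
  Tendsto (fun n => P {ω | ¬ E n ω}) atTop (𝓝 0)

namespace HighProb

variable {Ω : Type*} [MeasurableSpace Ω] {P : Measure Ω} {E F : ℕ → Ω → Prop}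

theorem mono (hE : HighProb P E) (h : ∀ᶠ n in atTop, ∀ᵐ ω ∂P, E n ω → F n ω) :
    HighProb P F := by
  refine tendsto_of_tendsto_of_tendsto_of_le_of_le' tendsto_const_nhds hE
    (Eventually.of_forall fun _ => zero_le) ?_
  filter_upwards [h] with n hn
  refine measure_mono_ae ?_
  filter_upwards [hn] with ω hω hF hE' using hF (hω hE')

theorem and (hE : HighProb P E) (hF : HighProb P F) : HighProb P fun n ω => E n ω ∧ F n ω := by
  have h := hE.add hF
  rw [add_zero] at h
  refine tendsto_of_tendsto_of_tendsto_of_le_of_le tendsto_const_nhds h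
    (fun _ => zero_le) fun n => ?_
  refine (measure_mono fun ω hω => ?_).trans (measure_union_le _ _)
  exact not_and_or.1 hω

theorem of_ae (h : ∀ n, ∀ᵐ ω ∂P, E n ω) : HighProb P E := by
  have : ∀ n, P {ω | ¬ E n ω} = 0 := fun n => ae_iff.1 (h n)
  simp [HighProb, this]

/-- An almost sure bound on the limit superior becomes a bound on an event of probability tending to
one. The functions have to be measurable, since outer measure is not continuous from above. -/
theorem lt_of_limsup_le [IsFiniteMeasure P] {V : ℕ → Ω → ℝ≥0∞} (hV : ∀ n, AEMeasurable (V n) P)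
    {a b : ℝ≥0∞} (hab : a < b) (h : ∀ᵐ ω ∂P, limsup (fun n => V n ω) atTop ≤ a) :
    HighProb P fun n ω => V n ω < b := by
  have hA : Tendsto (fun n => P {ω | b ≤ (hV n).mk (V n) ω}) atTop (𝓝 (P ∅)) := by
    refine tendsto_measure_of_ae_tendsto_indicator_of_isFiniteMeasure _ MeasurableSet.empty
      (fun n => measurableSet_le measurable_const (hV n).measurable_mk) ?_
    filter_upwards [h, ae_all_iff.2 fun n => (hV n).ae_eq_mk] with ω hω hmk
    filter_upwards [eventually_lt_of_limsup_lt (hω.trans_lt hab)] with n hn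
    simpa [← hmk n] using hn
  rw [measure_empty] at hA
  have hA' : HighProb P fun n ω => (hV n).mk (V n) ω < b := by simpa [HighProb] using hA
  refine hA'.mono (Eventually.of_forall fun n => ?_)
  filter_upwards [(hV n).ae_eq_mk] with ω hω
  rw [hω]
  exact id

end HighProb

/-! ### Law of large numbers and Wald's argument -/

section LLN

variable {Ω W : Type*} [MeasurableSpace Ω] [MeasurableSpace W] {P : Measure Ω}
  [IsProbabilityMeasure P] {μ : Measure W} {Y : ℕ → Ω → W}

theorem highProb_abs_average_sub_lt (h_indep : iIndepFun Y P) (h_law : ∀ i, HasLaw (Y i) μ P)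
    {F : W → ℝ} (hF : Integrable F μ) {ε : ℝ} (hε : 0 < ε) :
    HighProb P fun n ω => |(∑ i : Fin n, F (Y i ω)) / n - ∫ w, F w ∂μ| < ε := by
  have hFm : ∀ i, AEMeasurable F (P.map (Y i)) := fun i => by
    rw [(h_law i).map_eq]; exact hF.1.aemeasurable
  have hm : ∀ i, AEMeasurable (F ∘ Y i) P := fun i =>
    (hFm i).comp_aemeasurable (h_law i).aemeasurable
  have hind := h_indep.comp₀ (fun _ => F) (fun i => (h_law i).aemeasurable) hFm
  have hint : Integrable (F ∘ Y 0) P :=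
    (show Integrable F (P.map (Y 0)) by rwa [(h_law 0).map_eq]).comp_aemeasurable
      (h_law 0).aemeasurable
  have hid : ∀ i, IdentDistrib (F ∘ Y i) (F ∘ Y 0) P P := fun i =>
    ((h_law i).identDistrib (h_law 0)).comp_of_aemeasurable (hFm i)
  have hmean : ∫ ω, (F ∘ Y 0) ω ∂P = ∫ w, F w ∂μ := by
    rw [← (h_law 0).map_eq, integral_map (h_law 0).aemeasurable
      (hFm 0).aestronglyMeasurable]; rfl
  have hlln := strong_law_ae_real (fun i => F ∘ Y i) hint
    (fun i j hij => hind.indepFun hij) hid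
  rw [hmean] at hlln
  have := tendstoInMeasure_of_tendsto_ae
    (fun n => ((Finset.aemeasurable_fun_sum _ fun i _ => hm i).div_const _).aestronglyMeasurable)
    hlln
  refine (tendstoInMeasure_iff_dist.1 this ε hε).congr fun n => ?_
  congr 1
  ext ω
  simp only [mem_ofPred_eq, not_lt, Real.dist_eq, Function.comp_apply]
  rw [Fin.sum_univ_eq_sum_range (fun i => F (Y i ω)) n]

variable {E : Type*} [PseudoMetricSpace E] {B : Set E} {G : E → W → ℝ} {H : W → ℝ}

/-- Near a point `b ∈ B`, the functions `G x`, `x ∈ B`, have a common upper bound whose integral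
is as close to that of `G b` as desired. The bound is a supremum over a countable dense set. -/
theorem exists_integrable_local_bound (hB : IsCompact B)
    (hG : ∀ x ∈ B, AEStronglyMeasurable (G x) μ)
    (hcont : ∀ᵐ w ∂μ, ContinuousOn (fun x => G x w) B)
    (hGH : ∀ᵐ w ∂μ, ∀ x ∈ B, |G x w| ≤ H w) (hH : Integrable H μ) {b : E} (hb : b ∈ B) {a : ℝ}
    (ha : ∫ w, G b w ∂μ < a) :
    ∃ ρ > 0, ∃ S : W → ℝ, Integrable S μ ∧ ∫ w, S w ∂μ < a ∧
      ∀ᵐ w ∂μ, ∀ x ∈ B, dist x b < ρ → G x w ≤ S w := by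
  obtain ⟨D, hDB, hDc, hBD⟩ := hB.isSeparable.exists_countable_dense_subset
  let ρ : ℕ → ℝ := fun m => 1 / ((m : ℝ) + 1)
  have hρ : ∀ m, 0 < ρ m := fun m => Nat.one_div_pos_of_nat
  let I : ℕ → Set E := fun m => Metric.ball b (ρ m) ∩ D
  have hIB : ∀ m, I m ⊆ B := fun m => inter_subset_right.trans hDB
  have hcl : ∀ m, ∀ x ∈ B, dist x b < ρ m → x ∈ closure (I m) := fun m x hx hxb =>
    Metric.isOpen_ball.inter_closure ⟨hxb, hBD hx⟩
  have hne : ∀ m, (I m).Nonempty := fun m =>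
    closure_nonempty_iff.1 ⟨b, hcl m b hb (by rw [dist_self]; exact hρ m)⟩
  let S : ℕ → W → ℝ := fun m w => ⨆ x : I m, G x w
  have hSm : ∀ m, AEStronglyMeasurable (S m) μ := fun m => by
    have : Countable (I m) := (hDc.mono inter_subset_right).to_subtype
    exact (AEMeasurable.iSup fun x : I m => (hG x (hIB m x.2)).aemeasurable).aestronglyMeasurable
  have hbdd : ∀ w, (∀ x ∈ B, |G x w| ≤ H w) → ∀ m,
      BddAbove (range fun x : I m => G x w) := fun w hw m =>
    ⟨H w, by rintro _ ⟨x, rfl⟩; exact (le_abs_self _).trans (hw x (hIB m x.2))⟩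
  have hSH : ∀ m, ∀ᵐ w ∂μ, ‖S m w‖ ≤ H w := fun m => by
    filter_upwards [hGH] with w hw
    obtain ⟨x, hx⟩ := hne m
    have : Nonempty (I m) := ⟨⟨x, hx⟩⟩
    rw [Real.norm_eq_abs, abs_le]
    exact ⟨(neg_le_of_abs_le (hw x (hIB m hx))).trans (le_ciSup (hbdd w hw m) ⟨x, hx⟩),
      ciSup_le fun y => (le_abs_self _).trans (hw y (hIB m y.2))⟩
  have hbound : ∀ m, ∀ᵐ w ∂μ, ∀ x ∈ B, dist x b < ρ m → G x w ≤ S m w := fun m => by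
    filter_upwards [hGH, hcont] with w hw hc x hx hxb
    have hx' := hcl m x hx hxb
    have hnb := mem_closure_iff_nhdsWithin_neBot.1 hx'
    refine le_of_tendsto ((hc x hx).mono (hIB m)) ?_
    filter_upwards [self_mem_nhdsWithin] with y hy using le_ciSup (hbdd w hw m) ⟨y, hy⟩
  have hlim : ∀ᵐ w ∂μ, Tendsto (fun m => S m w) atTop (𝓝 (G b w)) := by
    filter_upwards [hcont, ae_all_iff.2 hbound] with w hc hSb
    refine Metric.tendsto_atTop.2 fun ε hε => ?_
    obtain ⟨κ, hκ, hball⟩ := Metric.continuousWithinAt_iff.1 (hc b hb) (ε / 2) (half_pos hε)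
    obtain ⟨N, hN⟩ := exists_nat_one_div_lt hκ
    refine ⟨N, fun m hm => ?_⟩
    have hmκ : ρ m < κ := (Nat.one_div_le_one_div hm).trans_lt hN
    have : Nonempty (I m) := (hne m).to_subtype
    have hle : S m w ≤ G b w + ε / 2 := ciSup_le fun x => by
      have := hball (hIB m x.2) (lt_trans x.2.1 hmκ)
      rw [Real.dist_eq] at this
      linarith [(abs_lt.1 this).2]
    have hge := hSb m b hb (by rw [dist_self]; exact hρ m)
    rw [Real.dist_eq, abs_lt]
    constructor <;> linarith
  have hint := tendsto_integral_of_dominated_convergence H hSm hH hSH hlim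
  obtain ⟨m, hm⟩ := (hint.eventually (gt_mem_nhds ha)).exists
  exact ⟨ρ m, hρ m, S m, hH.mono' (hSm m) (hSH m), hm, hbound m⟩

/-- Wald's argument: if the mean of `G` over `B` is maximal only at `b₀`, then, with probability
tending to one, the sample mean of `G` at `b₀` exceeds by a fixed margin its values away
from `b₀`. -/
theorem exists_highProb_average_add_le (h_indep : iIndepFun Y P) (h_law : ∀ i, HasLaw (Y i) μ P)
    (hB : IsCompact B) (hG : ∀ x ∈ B, AEStronglyMeasurable (G x) μ)
    (hcont : ∀ᵐ w ∂μ, ContinuousOn (fun x => G x w) B)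
    (hGH : ∀ᵐ w ∂μ, ∀ x ∈ B, |G x w| ≤ H w) (hH : Integrable H μ) {b₀ : E} (hb₀ : b₀ ∈ B)
    {s : Set E} (hs : IsCompact s) (hsB : s ⊆ B)
    (hmax : ∀ b ∈ s, ∫ w, G b w ∂μ < ∫ w, G b₀ w ∂μ) :
    ∃ κ > 0, HighProb P fun n ω => ∀ b ∈ s,
      (∑ i : Fin n, G b (Y i ω)) / n + κ ≤ (∑ i : Fin n, G b₀ (Y i ω)) / n := by
  refine hs.induction_on (p := fun t => ∃ κ > 0, HighProb P fun n ω => ∀ b ∈ t,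
      (∑ i : Fin n, G b (Y i ω)) / n + κ ≤ (∑ i : Fin n, G b₀ (Y i ω)) / n) ?_ ?_ ?_ ?_
  · exact ⟨1, one_pos, HighProb.of_ae fun n => by simp⟩
  · rintro t t' htt' ⟨κ, hκ, h⟩
    exact ⟨κ, hκ, h.mono (Eventually.of_forall fun n => Eventually.of_forall fun ω hω b hb =>
      hω b (htt' hb))⟩
  · rintro t t' ⟨κ, hκ, h⟩ ⟨κ', hκ', h'⟩
    refine ⟨min κ κ', lt_min hκ hκ', (h.and h').mono (Eventually.of_forall fun n =>
      Eventually.of_forall fun ω hω b hb => ?_)⟩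
    rcases hb with hb | hb
    · linarith [hω.1 b hb, min_le_left κ κ']
    · linarith [hω.2 b hb, min_le_right κ κ']
  · intro b hb
    obtain ⟨ρ, hρ, S, hS, hSlt, hGS⟩ :=
      exists_integrable_local_bound hB hG hcont hGH hH (hsB hb) (hmax b hb)
    have hG₀ : Integrable (G b₀) μ := hH.mono' (hG b₀ hb₀) (by
      filter_upwards [hGH] with w hw using hw b₀ hb₀)
    set κ := (∫ w, G b₀ w ∂μ - ∫ w, S w ∂μ) / 3 with hκ_def
    have hκ : 0 < κ := by rw [hκ_def]; linarith
    refine ⟨s ∩ Metric.ball b ρ, inter_mem_nhdsWithin _ (Metric.ball_mem_nhds b hρ), κ, hκ, ?_⟩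
    refine ((highProb_abs_average_sub_lt h_indep h_law hS hκ).and
      (highProb_abs_average_sub_lt h_indep h_law hG₀ hκ)).mono (Eventually.of_forall fun n => ?_)
    have hY : ∀ i, ∀ᵐ ω ∂P, ∀ x ∈ B, dist x b < ρ → G x (Y i ω) ≤ S (Y i ω) := fun i =>
      ae_of_ae_map (h_law i).aemeasurable (by rwa [(h_law i).map_eq])
    filter_upwards [ae_all_iff.2 hY] with ω hω hE x hx
    have hle : (∑ i : Fin n, G x (Y i ω)) / n ≤ (∑ i : Fin n, S (Y i ω)) / n := by
      gcongr with i
      exact hω i x (hsB hx.1) hx.2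
    have h1 := abs_lt.1 hE.1
    have h2 := abs_lt.1 hE.2
    linarith [h1.2, h2.1]

end LLN

/-! ### Measurability of the criterion -/

theorem measurable_coord {n : ℕ} (k : Fin n) : Measurable fun v : Vec n => v k := by fun_prop

theorem measurableSet_openCube (d : ℕ) : MeasurableSet (openCube d) := by
  simp only [openCube, ofPred_forall]
  exact MeasurableSet.iInter fun k => measurable_coord k measurableSet_Ioo

theorem measurableSet_trimCube (d : ℕ) (ν : ℝ) : MeasurableSet (trimCube d ν) := by
  simp only [trimCube, ofPred_forall]
  exact MeasurableSet.iInter fun k => measurable_coord k measurableSet_Icc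

theorem measurableSet_covBox (p : ℕ) (Mz : ℝ) : MeasurableSet (covBox p Mz) := by
  simp only [covBox, ofPred_forall]
  exact MeasurableSet.iInter fun k => measurable_coord k measurableSet_Icc

section Model

variable {d p q : ℕ} (μ : Measure (Vec d × Vec p)) [IsProbabilityMeasure μ]

theorem measurable_condPIT : Measurable (condPIT μ) := by
  refine (WithLp.measurable_toLp 2 _).comp (measurable_pi_lambda _ fun k => ?_)
  let κ : Kernel (Vec p × ℝ) (Vec d) :=
    (condDistrib Prod.fst Prod.snd μ).comap Prod.fst measurable_fst
  have hset : MeasurableSet {a : (Vec p × ℝ) × Vec d | a.2 k ≤ a.1.2} :=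
    measurableSet_le ((measurable_coord k).comp measurable_snd) (by fun_prop)
  have hmeas : Measurable fun a : Vec p × ℝ => (κ a {v | v k ≤ a.2}).toReal :=
    (Kernel.measurable_kernel_prodMk_left (κ := κ) hset).ennreal_toReal
  have heq : (fun w : Vec d × Vec p => condMarginalCDF μ k w.2 (w.1 k)) =
      (fun a : Vec p × ℝ => (κ a {v | v k ≤ a.2}).toReal) ∘ fun w => (w.2, w.1 k) := by
    ext w
    have : IsProbabilityMeasure ((condLaw μ w.2).map fun v => v k) := by
      unfold condLaw
      exact Measure.isProbabilityMeasure_map (measurable_coord k).aemeasurable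
    rw [condMarginalCDF, cdf_eq_real, measureReal_def,
      Measure.map_apply (measurable_coord k) measurableSet_Iic]
    rfl
  rw [heq]
  exact hmeas.comp (measurable_snd.prodMk ((measurable_coord k).comp measurable_fst))

variable {μ}

/-- A copula density charges only the open cube, hence so does the vector `U`. -/
theorem ae_condPIT_mem_openCube {f : Vec p → Vec d → ℝ}
    (h : ∀ᵐ z ∂(μ.map Prod.snd),
      (condLaw μ z).map (fun x => condPIT μ (x, z)) = densityMeasure (f z)) :
    ∀ᵐ w ∂μ, condPIT μ w ∈ openCube d := by
  have hm := measurable_condPIT μ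
  have hset : MeasurableSet {a : Vec p × Vec d | condPIT μ (a.2, a.1) ∈ openCube d} :=
    (hm.comp (measurable_snd.prodMk measurable_fst)) (measurableSet_openCube d)
  have h1 : ∀ᵐ a ∂((μ.map Prod.snd) ⊗ₘ condDistrib Prod.fst Prod.snd μ),
      condPIT μ (a.2, a.1) ∈ openCube d := by
    rw [Measure.ae_compProd_iff hset]
    filter_upwards [h] with z hz
    refine ae_of_ae_map (hm.comp (measurable_id.prodMk measurable_const)).aemeasurable ?_
    change ∀ᵐ y ∂((condLaw μ z).map fun x => condPIT μ (x, z)), y ∈ openCube d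
    rw [hz]
    exact (withDensity_absolutelyContinuous _ _).ae_le
      (ae_restrict_mem (measurableSet_openCube d))
  rw [compProd_map_condDistrib measurable_fst.aemeasurable] at h1
  exact ae_of_ae_map (f := fun w : Vec d × Vec p => (w.2, w.1))
    (measurable_snd.prodMk measurable_fst).aemeasurable h1

/-- The log-density is continuous in the parameter and measurable in its argument, hence jointly
measurable. -/
theorem measurable_log_density {Θ : Set (Vec q)} {c : Vec q → Vec d → ℝ}
    (hθ : ∀ u ∈ openCube d, ContinuousOn (fun t => Real.log (c t u)) Θ)
    (hu : ∀ θ ∈ Θ, ContinuousOn (c θ) (openCube d)) :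
    Measurable fun a : Θ × openCube d => Real.log (c a.1 a.2) := by
  refine measurable_uncurry_of_continuous_of_measurable
    (u := fun (θ : Θ) (u : openCube d) => Real.log (c θ u)) (fun u => ?_) fun θ => ?_
  · exact continuousOn_iff_continuous_domRestrict.1 (hθ u u.2)
  · exact Real.measurable_log.comp
      (continuousOn_iff_continuous_domRestrict.1 (hu θ θ.2)).measurable

/-- The summand `𝟏(z ∈ [-Mz, Mz]^p) ln c_{ψ(b, b'z)}(U)` of the oracle criterion, which uses the
true margins and the true link function and does not trim `U`. -/
noncomputable def oracleTerm (μ : Measure (Vec d × Vec p)) [IsProbabilityMeasure μ]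
    (c : Vec q → Vec d → ℝ) (Mz : ℝ) (ψ : Vec p → ℝ → Vec q) (b : Vec p) : Vec d × Vec p → ℝ :=
  {w : Vec d × Vec p | w.2 ∈ covBox p Mz}.indicator
    fun w => Real.log (c (ψ b (inner ℝ b w.2)) (condPIT μ w))

variable {c : Vec q → Vec d → ℝ} {Mz : ℝ} {ψ : Vec p → ℝ → Vec q} {b : Vec p}

theorem measurableSet_snd_mem_covBox :
    MeasurableSet {w : Vec d × Vec p | w.2 ∈ covBox p Mz} :=
  measurable_snd (measurableSet_covBox p Mz)

theorem aestronglyMeasurable_oracleTerm {Θ : Set (Vec q)}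
    (hθ : ∀ u ∈ openCube d, ContinuousOn (fun t => Real.log (c t u)) Θ)
    (hu : ∀ θ ∈ Θ, ContinuousOn (c θ) (openCube d)) (hψ : Measurable (ψ b))
    (hψΘ : ∀ z ∈ covBox p Mz, ψ b (inner ℝ b z) ∈ Θ)
    (hU : ∀ᵐ w ∂μ, condPIT μ w ∈ openCube d) :
    AEStronglyMeasurable (oracleTerm μ c Mz ψ b) μ := by
  refine AEMeasurable.aestronglyMeasurable ?_
  rw [oracleTerm, aemeasurable_indicator_iff measurableSet_snd_mem_covBox]
  have hA : MeasurableSet {w : Vec d × Vec p | w.2 ∈ covBox p Mz ∧ condPIT μ w ∈ openCube d} :=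
    measurableSet_snd_mem_covBox.inter (measurable_condPIT μ (measurableSet_openCube d))
  have hmem : ∀ w : {w : Vec d × Vec p | w.2 ∈ covBox p Mz ∧ condPIT μ w ∈ openCube d},
      w.1.2 ∈ covBox p Mz ∧ condPIT μ w.1 ∈ openCube d := fun w => w.2
  have hr : μ.restrict {w : Vec d × Vec p | w.2 ∈ covBox p Mz} =
      μ.restrict {w : Vec d × Vec p | w.2 ∈ covBox p Mz ∧ condPIT μ w ∈ openCube d} :=
    Measure.restrict_congr_set (by
      filter_upwards [hU] with w hw
      exact propext ⟨fun h => ⟨h, hw⟩, fun h => h.1⟩)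
  rw [hr]
  refine aemeasurable_restrict_of_measurable_subtype hA ?_
  refine (measurable_log_density hθ hu).comp (f := fun w => (⟨_, hψΘ _ (hmem w).1⟩,
    ⟨_, (hmem w).2⟩)) (Measurable.prodMk ?_ ?_)
  · refine Measurable.subtype_mk (hψ.comp ?_)
    fun_prop
  · exact ((measurable_condPIT μ).comp measurable_subtype_coe).subtype_mk

theorem limitCriterion_eq_integral_oracleTerm :
    limitCriterion μ c Mz ψ b =
      (μ {w | w.2 ∈ covBox p Mz})⁻¹.toReal * ∫ w, oracleTerm μ c Mz ψ b w ∂μ := by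
  rw [limitCriterion, ProbabilityTheory.cond, integral_smul_measure, oracleTerm,
    integral_indicator measurableSet_snd_mem_covBox, smul_eq_mul]

end Model

/-! ### The oracle criterion -/

section Oracle

variable {d p q : ℕ} {μ : Measure (Vec d × Vec p)} [IsProbabilityMeasure μ]
  {c : Vec q → Vec d → ℝ} {Mz : ℝ} {ψ : Vec p → ℝ → Vec q} {B : Set (Vec p)}
  {h : Vec d × Vec p → ℝ}

theorem integrableOn_of_rpow {α : Type*} [MeasurableSpace α] {m : Measure α} {s : Set α}
    (hs : MeasurableSet s) (hm : m s ≠ ∞) {f : α → ℝ} {a : ℝ} (ha : 1 ≤ a)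
    (hf : AEStronglyMeasurable f m) (hpos : ∀ᵐ x ∂m, x ∈ s → 0 ≤ f x)
    (hint : IntegrableOn (fun x => f x ^ a) s m) : IntegrableOn f s m := by
  have h1 : IntegrableOn (fun _ : α => (1 : ℝ)) s m := integrableOn_const hm
  refine (h1.add hint).mono' hf.restrict ?_
  filter_upwards [(ae_restrict_iff' hs).2 hpos] with x hx
  rw [Real.norm_eq_abs, abs_of_nonneg hx, Pi.add_apply]
  rcases le_total (f x) 1 with h | h
  · linarith [Real.rpow_nonneg hx a]
  · linarith [Real.self_le_rpow_of_one_le h ha]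

open Classical in
/-- The contribution of the observations with `U` outside `trimCube d ρ` to the mean of the
envelope. -/
noncomputable def envelopeTail (μ : Measure (Vec d × Vec p)) [IsProbabilityMeasure μ] (Mz : ℝ)
    (h : Vec d × Vec p → ℝ) (ρ : ℝ) : Vec d × Vec p → ℝ :=
  {w : Vec d × Vec p | w.2 ∈ covBox p Mz}.indicator
    fun w => if condPIT μ w ∈ trimCube d ρ then 0 else h (condPIT μ w, w.2)

theorem norm_envelopeTail_le (ρ : ℝ) (w : Vec d × Vec p) :
    ‖envelopeTail μ Mz h ρ w‖ ≤ ‖{w : Vec d × Vec p | w.2 ∈ covBox p Mz}.indicator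
      (fun w => h (condPIT μ w, w.2)) w‖ := by
  rw [envelopeTail]
  by_cases hw : w ∈ {w : Vec d × Vec p | w.2 ∈ covBox p Mz}
  · rw [indicator_of_mem hw, indicator_of_mem hw]
    split_ifs <;> simp
  · rw [indicator_of_notMem hw, indicator_of_notMem hw]

theorem measurable_envelopeTail (hh : Measurable h) (ρ : ℝ) :
    Measurable (envelopeTail μ Mz h ρ) := by
  refine Measurable.indicator ?_ measurableSet_snd_mem_covBox
  exact Measurable.ite (measurable_condPIT μ (measurableSet_trimCube d ρ)) measurable_const
    (hh.comp ((measurable_condPIT μ).prodMk measurable_snd))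

theorem exists_integral_envelopeTail_lt (hU : ∀ᵐ w ∂μ, condPIT μ w ∈ openCube d)
    (hh : Measurable h)
    (hint : IntegrableOn (fun w => h (condPIT μ w, w.2)) {w | w.2 ∈ covBox p Mz} μ)
    {ε : ℝ} (hε : 0 < ε) : ∃ ρ > 0, ∫ w, envelopeTail μ Mz h ρ w ∂μ < ε := by
  have hlim : ∀ᵐ w ∂μ, Tendsto (fun m : ℕ => envelopeTail μ Mz h (1 / ((m : ℝ) + 1)) w)
      atTop (𝓝 0) := by
    filter_upwards [hU] with w hw
    have hev : ∀ᶠ m : ℕ in atTop, condPIT μ w ∈ trimCube d (1 / ((m : ℝ) + 1)) := by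
      have : ∀ k, ∀ᶠ m : ℕ in atTop,
          condPIT μ w k ∈ Icc (1 / ((m : ℝ) + 1)) (1 - 1 / ((m : ℝ) + 1)) := fun k => by
        have ht := tendsto_one_div_add_atTop_nhds_zero_nat (𝕜 := ℝ)
        filter_upwards [ht.eventually (gt_mem_nhds (hw k).1),
          ht.eventually (gt_mem_nhds (sub_pos.2 (hw k).2))] with m h1 h2
        exact ⟨h1.le, by linarith⟩
      exact eventually_all.2 this
    refine tendsto_const_nhds.congr' ?_
    filter_upwards [hev] with m hm
    simp only [envelopeTail, indicator, if_pos hm, ite_self]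
  have h0 := tendsto_integral_of_dominated_convergence _
    (fun m : ℕ => (measurable_envelopeTail (μ := μ) (Mz := Mz) hh
      (1 / ((m : ℝ) + 1))).aestronglyMeasurable)
    (hint.integrable_indicator measurableSet_snd_mem_covBox).norm
    (fun m => ae_of_all _ fun w => norm_envelopeTail_le _ w) hlim
  rw [integral_zero] at h0
  obtain ⟨m, hm⟩ := (h0.eventually (gt_mem_nhds hε)).exists
  exact ⟨_, Nat.one_div_pos_of_nat, hm⟩

theorem integrable_envelopeTail (hh : Measurable h)
    (hint : IntegrableOn (fun w => h (condPIT μ w, w.2)) {w | w.2 ∈ covBox p Mz} μ) (ρ : ℝ) :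
    Integrable (envelopeTail μ Mz h ρ) μ :=
  (hint.integrable_indicator measurableSet_snd_mem_covBox).norm.mono'
    (measurable_envelopeTail hh ρ).aestronglyMeasurable
    (ae_of_all _ fun w => norm_envelopeTail_le ρ w)

theorem ae_continuousOn_oracleTerm
    (h_cont : ∀ᵐ w ∂μ, w.2 ∈ covBox p Mz →
      ContinuousOn (fun b => Real.log (c (ψ b (inner ℝ b w.2)) (condPIT μ w))) B) :
    ∀ᵐ w ∂μ, ContinuousOn (fun b => oracleTerm μ c Mz ψ b w) B := by
  filter_upwards [h_cont] with w hw
  by_cases hwz : w.2 ∈ covBox p Mz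
  · simpa [oracleTerm, indicator, hwz] using hw hwz
  · simpa [oracleTerm, indicator, hwz] using continuousOn_const

theorem ae_abs_oracleTerm_le
    (h_env : ∀ᵐ w ∂μ, w.2 ∈ covBox p Mz → ∀ b ∈ B,
      |Real.log (c (ψ b (inner ℝ b w.2)) (condPIT μ w))| ≤ h (condPIT μ w, w.2)) :
    ∀ᵐ w ∂μ, ∀ b ∈ B, |oracleTerm μ c Mz ψ b w| ≤
      {w : Vec d × Vec p | w.2 ∈ covBox p Mz}.indicator (fun w => h (condPIT μ w, w.2)) w := by
  filter_upwards [h_env] with w hw b hb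
  by_cases hwz : w.2 ∈ covBox p Mz
  · simpa [oracleTerm, indicator, hwz] using hw hwz b hb
  · simp [oracleTerm, indicator, hwz]

end Oracle

/-! ### Closeness of the feasible and the oracle criterion -/

section Remainder

open Classical in
theorem trim_mul_of_mem_covBox {d p : ℕ} {ν Mz : ℝ} {u : Vec d} {z : Vec p}
    (hz : z ∈ covBox p Mz) (x : ℝ) :
    trim ν Mz u z * x = if u ∈ trimCube d ν then x else 0 := by
  by_cases hv : u ∈ trimCube d ν <;> simp [trim, hv, hz]

variable {d p q : ℕ} {Ω : Type*} [MeasurableSpace Ω] {P : Measure Ω} [IsProbabilityMeasure P]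
  {μ : Measure (Vec d × Vec p)} [IsProbabilityMeasure μ]
  {X : ℕ → Ω → Vec d} {Z : ℕ → Ω → Vec p} {Mz : ℝ}

theorem highProb_norm_pseudo_sub_le (h_law : ∀ i, HasLaw (fun ω => (X i ω, Z i ω)) μ P)
    {Uhat : (n : ℕ) → Fin n → Ω → Vec d} (hUhat_meas : ∀ n i, AEMeasurable (Uhat n i) P)
    {δ : ℕ → ℝ} (hδ_pos : ∀ n, 0 < δ n)
    (hUhat : ∀ᵐ ω ∂P, limsup (fun n => ⨆ i : Fin n,
      ENNReal.ofReal (‖Uhat n i ω - condPIT μ (X i ω, Z i ω)‖ *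
        (covBox p Mz).indicator (fun _ => (1 : ℝ)) (Z i ω) / δ n)) atTop ≤ 1) :
    HighProb P fun n ω => ∀ i : Fin n, Z i ω ∈ covBox p Mz →
      ‖Uhat n i ω - condPIT μ (X i ω, Z i ω)‖ ≤ 2 * δ n := by
  have hm : ∀ n, AEMeasurable (fun ω => ⨆ i : Fin n,
      ENNReal.ofReal (‖Uhat n i ω - condPIT μ (X i ω, Z i ω)‖ *
        (covBox p Mz).indicator (fun _ => (1 : ℝ)) (Z i ω) / δ n)) P := fun n => by
    refine AEMeasurable.iSup fun i => ?_
    have h1 : AEMeasurable (fun ω => condPIT μ (X i ω, Z i ω)) P :=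
      (measurable_condPIT μ).comp_aemeasurable (h_law i).aemeasurable
    have h2 : AEMeasurable (fun ω => (covBox p Mz).indicator (fun _ => (1 : ℝ)) (Z i ω)) P :=
      (measurable_const.indicator (measurableSet_covBox p Mz)).comp_aemeasurable
        (measurable_snd.comp_aemeasurable (h_law i).aemeasurable)
    exact ((((hUhat_meas n i).sub h1).norm.mul h2).div_const _).ennreal_ofReal
  refine (HighProb.lt_of_limsup_le hm ENNReal.one_lt_two hUhat).mono
    (Eventually.of_forall fun n => Eventually.of_forall fun ω hω i hi => ?_)
  have h1 := (le_iSup (fun i : Fin n => ENNReal.ofReal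
    (‖Uhat n i ω - condPIT μ (X i ω, Z i ω)‖ *
      (covBox p Mz).indicator (fun _ => (1 : ℝ)) (Z i ω) / δ n)) i).trans_lt hω
  rw [indicator_of_mem hi, mul_one, ENNReal.ofReal_lt_ofNat, div_lt_iff₀ (hδ_pos n)] at h1
  exact h1.le

/-- Uniformly over `B`, the averaged pseudo-log-likelihood and its oracle counterpart differ by
a quantity that tends to zero in probability. -/
theorem highProb_abs_criterion_sub_oracle_le
    (h_indep : iIndepFun (fun i ω => (X i ω, Z i ω)) P)
    (h_law : ∀ i, HasLaw (fun ω => (X i ω, Z i ω)) μ P)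
    (hU : ∀ᵐ w ∂μ, condPIT μ w ∈ openCube d)
    {Θ : Set (Vec q)} (hΘ_paths : LocallyQuasiconvex Θ) {c : Vec q → Vec d → ℝ}
    {B : Set (Vec p)} {ψ : Vec p → ℝ → Vec q}
    {ν : ℕ → ℝ} (hν : ∀ n, ν n ∈ Ioo (0 : ℝ) (1 / 2)) (hν_lim : Tendsto ν atTop (𝓝 0))
    (hψ_mem : ∀ b ∈ B, ∀ z ∈ covBox p Mz, ψ b (inner ℝ b z) ∈ Θ)
    {h : Vec d × Vec p → ℝ} (hh_meas : Measurable h)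
    (h_env : ∀ᵐ w ∂μ, w.2 ∈ covBox p Mz → ∀ b ∈ B,
      |Real.log (c (ψ b (inner ℝ b w.2)) (condPIT μ w))| ≤ h (condPIT μ w, w.2))
    (hh_int : IntegrableOn (fun w => h (condPIT μ w, w.2)) {w | w.2 ∈ covBox p Mz} μ)
    {ψhat : ℕ → Ω → Vec p → ℝ → Vec q}
    (hψhat_mem : ∀ n ω, ∀ b ∈ B, ∀ z ∈ covBox p Mz, ψhat n ω b (inner ℝ b z) ∈ Θ)
    (hψhat : ∀ ε : ℝ, 0 < ε → HighProb P fun n ω => ∀ z ∈ covBox p Mz, ∀ b ∈ B,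
      ‖ψhat n ω b (inner ℝ b z) - ψ b (inner ℝ b z)‖ ≤ ε)
    {Uhat : (n : ℕ) → Fin n → Ω → Vec d}
    (hUhat_mem : ∀ n i, ∀ᵐ ω ∂P, Uhat n i ω ∈ openCube d)
    {δ : ℕ → ℝ} (hδ_pos : ∀ n, 0 < δ n) (hδ : δ =o[atTop] ν)
    (hUhat : HighProb P fun n ω => ∀ i : Fin n, Z i ω ∈ covBox p Mz →
      ‖Uhat n i ω - condPIT μ (X i ω, Z i ω)‖ ≤ 2 * δ n)
    {r : Vec d → ℝ} (hr : IsReproducingProd r)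
    (h_grad : ∀ u ∈ openCube d, ∀ θ ∈ Θ, ∃ g : Vec q,
      HasGradientWithinAt (fun t => Real.log (c t u)) g Θ θ ∧ ‖g‖ ≤ r u)
    (hr_int : IntegrableOn (fun w => r (condPIT μ w)) {w | w.2 ∈ covBox p Mz} μ)
    {rt : Fin d → Vec d → ℝ} (hrt : ∀ k, IsReproducingProd (rt k))
    (h_partial : ∀ k, ∀ u ∈ openCube d, ∀ θ ∈ Θ, ∃ a : ℝ,
      HasLineDerivAt ℝ (fun v => Real.log (c θ v)) a u (EuclideanSpace.single k 1) ∧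
        |a| ≤ rt k u)
    (hrt_int : ∀ k, IntegrableOn
      (fun w => condPIT μ w k * (1 - condPIT μ w k) * rt k (condPIT μ w))
      {w | w.2 ∈ covBox p Mz} μ) {κ : ℝ} (hκ : 0 < κ) :
    HighProb P fun n ω => ∀ b ∈ B,
      |criterion c (ν n) Mz (ψhat n ω) (fun i => Uhat n i ω) (fun i : Fin n => Z i ω) b / n -
        (∑ i : Fin n, oracleTerm μ c Mz ψ b (X i ω, Z i ω)) / n| ≤ κ := by
  obtain ⟨A, η, hA, hη, hbd⟩ := exists_abs_trimmed_log_sub_le hΘ_paths hr h_grad hrt h_partial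
  obtain ⟨ρ, hρ, hρT⟩ := exists_integral_envelopeTail_lt (Mz := Mz) hU hh_meas hh_int
    (show 0 < κ / 4 by positivity)
  let box : Set (Vec d × Vec p) := {w | w.2 ∈ covBox p Mz}
  let R : Vec d × Vec p → ℝ := box.indicator fun w => r (condPIT μ w)
  let S : Vec d × Vec p → ℝ := box.indicator fun w =>
    ∑ k, condPIT μ w k * (1 - condPIT μ w k) * rt k (condPIT μ w)
  let T : Vec d × Vec p → ℝ := envelopeTail μ Mz h ρ
  have hR : Integrable R μ := hr_int.integrable_indicator measurableSet_snd_mem_covBox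
  have hS : Integrable S μ := IntegrableOn.integrable_indicator
    (integrable_finsetSum _ fun k _ => hrt_int k) measurableSet_snd_mem_covBox
  have hT : Integrable T μ := integrable_envelopeTail hh_meas hh_int ρ
  have hCR : 0 < |∫ w, R w ∂μ| + 1 := by positivity
  have hCS : 0 < |∫ w, S w ∂μ| + 1 := by positivity
  set CR := |∫ w, R w ∂μ| + 1 with hCR_def
  set CS := |∫ w, S w ∂μ| + 1 with hCS_def
  -- the level at which the error of the link function becomes harmless
  obtain ⟨τ, hτ, hτη, hτκ⟩ : ∃ τ > 0, τ < η ∧ A * τ * CR ≤ κ / 4 := by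
    have ht : Tendsto (fun τ : ℝ => A * τ * CR) (𝓝[>] 0) (𝓝 0) := by
      have : Continuous fun τ : ℝ => A * τ * CR := by fun_prop
      simpa using (this.tendsto 0).mono_left nhdsWithin_le_nhds
    have h1 : ∀ᶠ τ in 𝓝[>] (0 : ℝ), τ ∈ Ioo 0 η := Ioo_mem_nhdsGT hη
    obtain ⟨τ, h2, h3⟩ :=
      (h1.and (ht.eventually (gt_mem_nhds (show 0 < κ / 4 by positivity)))).exists
    exact ⟨τ, h2.1, h2.2, h3.le⟩
  have hratio : Tendsto (fun n => δ n / ν n) atTop (𝓝 0) := hδ.tendsto_div_nhds_zero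
  have hn1 : ∀ᶠ n in atTop, 4 * δ n ≤ ν n := by
    filter_upwards [hratio.eventually (gt_mem_nhds (show (0 : ℝ) < 1 / 4 by norm_num))] with n hn
    rw [div_lt_iff₀ (hν n).1] at hn
    linarith
  have hn2 : ∀ᶠ n in atTop, ν n ≤ ρ / 2 :=
    (hν_lim.eventually (gt_mem_nhds (half_pos hρ))).mono fun n hn => hn.le
  have hn3 : ∀ᶠ n in atTop, A * (δ n / ν n) * CS ≤ κ / 4 := by
    have ht : Tendsto (fun n => A * (δ n / ν n) * CS) atTop (𝓝 0) := by
      simpa using (hratio.const_mul A).mul_const CS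
    exact (ht.eventually (gt_mem_nhds (show 0 < κ / 4 by positivity))).mono fun n hn => hn.le
  have hpush : ∀ {Q : Vec d × Vec p → Prop}, (∀ᵐ w ∂μ, Q w) →
      ∀ᵐ ω ∂P, ∀ i, Q (X i ω, Z i ω) := fun hQ => ae_all_iff.2 fun i =>
    ae_of_ae_map (h_law i).aemeasurable (by rwa [(h_law i).map_eq])
  have hevents := (((hψhat τ hτ).and hUhat).and
    ((highProb_abs_average_sub_lt h_indep h_law hR one_pos).and
      (highProb_abs_average_sub_lt h_indep h_law hS one_pos))).and
    (highProb_abs_average_sub_lt h_indep h_law hT (show 0 < κ / 4 by positivity))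
  refine hevents.mono ?_
  filter_upwards [hn1, hn2, hn3] with n hn1 hn2 hn3
  filter_upwards [hpush hU, hpush h_env, ae_all_iff.2 fun i => hUhat_mem n i]
    with ω hUω henvω hUhatω hE b hb
  obtain ⟨⟨⟨hE1, hE2⟩, hE3, hE4⟩, hE5⟩ := hE
  have hterm : ∀ i : Fin n, |trim (ν n) Mz (Uhat n i ω) (Z i ω) *
      Real.log (c (ψhat n ω b (inner ℝ b (Z i ω))) (Uhat n i ω)) -
        oracleTerm μ c Mz ψ b (X i ω, Z i ω)| ≤ A * τ * R (X i ω, Z i ω) +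
          A * (δ n / ν n) * S (X i ω, Z i ω) + T (X i ω, Z i ω) := by
    intro i
    by_cases hz : Z i ω ∈ covBox p Mz
    · have := hbd (ν n) (hν n) (δ n) (hδ_pos n) hn1 ρ (by linarith) _ (hUω i) _ (hUhatω i)
        (hE2 i hz) _ (hψ_mem b hb _ hz) _ (hψhat_mem n ω b hb _ hz) τ hτη (hE1 _ hz b hb) _
        (henvω i hz b hb)
      rw [trim_mul_of_mem_covBox hz]
      simpa [oracleTerm, indicator, hz, R, S, T, box, envelopeTail] using this
    · simp [trim, oracleTerm, indicator, hz, R, S, T, box, envelopeTail]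
  have havg : |criterion c (ν n) Mz (ψhat n ω) (fun i => Uhat n i ω) (fun i : Fin n => Z i ω) b /
        n - (∑ i : Fin n, oracleTerm μ c Mz ψ b (X i ω, Z i ω)) / n| ≤
      A * τ * ((∑ i : Fin n, R (X i ω, Z i ω)) / n) +
        A * (δ n / ν n) * ((∑ i : Fin n, S (X i ω, Z i ω)) / n) +
          (∑ i : Fin n, T (X i ω, Z i ω)) / n := by
    rw [← sub_div, abs_div, Nat.abs_cast, criterion, ← Finset.sum_sub_distrib, ← mul_div_assoc,
      ← mul_div_assoc, ← add_div, ← add_div]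
    gcongr
    refine (Finset.abs_sum_le_sum_abs _ _).trans ((Finset.sum_le_sum fun i _ => hterm i).trans ?_)
    rw [Finset.sum_add_distrib, Finset.sum_add_distrib, Finset.mul_sum, Finset.mul_sum]
  have hRle : (∑ i : Fin n, R (X i ω, Z i ω)) / n ≤ CR := by
    linarith [(abs_lt.1 hE3).2, le_abs_self (∫ w, R w ∂μ)]
  have hSle : (∑ i : Fin n, S (X i ω, Z i ω)) / n ≤ CS := by
    linarith [(abs_lt.1 hE4).2, le_abs_self (∫ w, S w ∂μ)]
  have hν0 := (hν n).1
  have hδ0 := hδ_pos n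
  have e1 : A * τ * ((∑ i : Fin n, R (X i ω, Z i ω)) / n) ≤ κ / 4 :=
    (mul_le_mul_of_nonneg_left hRle (by positivity)).trans hτκ
  have e2 : A * (δ n / ν n) * ((∑ i : Fin n, S (X i ω, Z i ω)) / n) ≤ κ / 4 :=
    (mul_le_mul_of_nonneg_left hSle (by positivity)).trans hn3
  linarith [(abs_lt.1 hE5).2]

end Remainder

end SingleIndexCopula

/-! ### Consistency of the estimator -/

open SingleIndexCopula in
theorem theorem1 {d p q : ℕ}
    -- the i.i.d. sample `(X i, Z i)`, with law `μ`
    {Ω : Type*} [MeasurableSpace Ω] (P : Measure Ω) [IsProbabilityMeasure P]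
    (μ : Measure (Vec d × Vec p)) [IsProbabilityMeasure μ]
    (X : ℕ → Ω → Vec d) (Z : ℕ → Ω → Vec p)
    (h_indep : iIndepFun (fun i ω => (X i ω, Z i ω)) P)
    (h_law : ∀ i, HasLaw (fun ω => (X i ω, Z i ω)) μ P)
    -- the parametric family of copula densities
    (Θ : Set (Vec q)) (hΘ_compact : IsCompact Θ) (hΘ_paths : LocallyQuasiconvex Θ)
    (c : Vec q → Vec d → ℝ) (hc : ∀ θ ∈ Θ, IsCopulaDensity (c θ))
    (hc_pos : ∀ θ ∈ Θ, ∀ u ∈ openCube d, 0 < c θ u)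
    -- the single-index model
    (B : Set (Vec p)) (hB : IsCompact B) (β₀ : Vec p) (hβ₀ : β₀ ∈ B)
    (ψ : Vec p → ℝ → Vec q) (hψ_meas : ∀ b ∈ B, Measurable (ψ b))
    (h_model : ∀ᵐ z ∂(μ.map Prod.snd), ψ β₀ (inner ℝ β₀ z) ∈ Θ ∧
      (condLaw μ z).map (fun x => condPIT μ (x, z)) =
        densityMeasure (c (ψ β₀ (inner ℝ β₀ z))))
    -- trimming
    (Mz : ℝ) (hMz : μ {w | w.2 ∈ covBox p Mz} ≠ 0)
    (ν : ℕ → ℝ) (hν : ∀ n, ν n ∈ Ioo (0 : ℝ) (1 / 2)) (hν_lim : Tendsto ν atTop (𝓝 0))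
    (hψ_mem : ∀ b ∈ B, ∀ z ∈ covBox p Mz, ψ b (inner ℝ b z) ∈ Θ)
    -- identification and envelope
    (hM_cont : ContinuousOn (limitCriterion μ c Mz ψ) B)
    (hM_max : ∀ b ∈ B, b ≠ β₀ → limitCriterion μ c Mz ψ b < limitCriterion μ c Mz ψ β₀)
    (h_cont : ∀ᵐ w ∂μ, w.2 ∈ covBox p Mz →
      ContinuousOn (fun b => Real.log (c (ψ b (inner ℝ b w.2)) (condPIT μ w))) B)
    (h : Vec d × Vec p → ℝ) (hh_meas : Measurable h) (α : ℝ) (hα : 1 < α)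
    (h_env : ∀ᵐ w ∂μ, w.2 ∈ covBox p Mz → ∀ b ∈ B,
      |Real.log (c (ψ b (inner ℝ b w.2)) (condPIT μ w))| ≤ h (condPIT μ w, w.2))
    (hh_int : IntegrableOn (fun w => h (condPIT μ w, w.2) ^ α) {w | w.2 ∈ covBox p Mz} μ)
    -- the estimated link function
    (ψhat : ℕ → Ω → Vec p → ℝ → Vec q)
    (hψhat_mem : ∀ n ω, ∀ b ∈ B, ∀ z ∈ covBox p Mz, ψhat n ω b (inner ℝ b z) ∈ Θ)
    (hψhat : ∀ ε : ℝ, 0 < ε → Tendsto (fun n => P {ω | ENNReal.ofReal ε <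
      ⨆ z ∈ covBox p Mz, ⨆ b ∈ B,
        ENNReal.ofReal ‖ψhat n ω b (inner ℝ b z) - ψ b (inner ℝ b z)‖}) atTop (𝓝 0))
    -- the pseudo-observations
    (Uhat : (n : ℕ) → Fin n → Ω → Vec d)
    (hUhat_meas : ∀ n i, AEMeasurable (Uhat n i) P)
    (hUhat_mem : ∀ n i, ∀ᵐ ω ∂P, Uhat n i ω ∈ openCube d)
    (δ : ℕ → ℝ) (hδ_pos : ∀ n, 0 < δ n) (hδ : δ =o[atTop] ν)
    (hUhat : ∀ᵐ ω ∂P, limsup (fun n => ⨆ i : Fin n,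
      ENNReal.ofReal (‖Uhat n i ω - condPIT μ (X i ω, Z i ω)‖ *
        (covBox p Mz).indicator (fun _ => (1 : ℝ)) (Z i ω) / δ n)) atTop ≤ 1)
    -- derivatives of the log-density and moments
    (r : Vec d → ℝ) (hr : IsReproducingProd r)
    (h_grad : ∀ u ∈ openCube d, ∀ θ ∈ Θ, ∃ g : Vec q,
      HasGradientWithinAt (fun t => Real.log (c t u)) g Θ θ ∧ ‖g‖ ≤ r u)
    (hr_int : IntegrableOn (fun w => r (condPIT μ w)) {w | w.2 ∈ covBox p Mz} μ)
    (rt : Fin d → Vec d → ℝ) (hrt : ∀ k, IsReproducingProd (rt k))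
    (h_partial : ∀ k, ∀ u ∈ openCube d, ∀ θ ∈ Θ, ∃ a : ℝ,
      HasLineDerivAt ℝ (fun v => Real.log (c θ v)) a u (EuclideanSpace.single k 1) ∧
        |a| ≤ rt k u)
    (hrt_int : ∀ k, IntegrableOn
      (fun w => condPIT μ w k * (1 - condPIT μ w k) * rt k (condPIT μ w))
      {w | w.2 ∈ covBox p Mz} μ)
    -- the estimator: any maximizer of the trimmed pseudo-log-likelihood over `B`
    (βhat : ℕ → Ω → Vec p)
    (hβhat : ∀ n, ∀ᵐ ω ∂P, βhat n ω ∈ B ∧ ∀ b ∈ B,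
      criterion c (ν n) Mz (ψhat n ω) (fun i => Uhat n i ω) (fun i : Fin n => Z i ω) b ≤
        criterion c (ν n) Mz (ψhat n ω) (fun i => Uhat n i ω) (fun i : Fin n => Z i ω)
          (βhat n ω)) :
    TendstoInMeasure P βhat atTop (fun _ => β₀) := by
  have hU : ∀ᵐ w ∂μ, condPIT μ w ∈ openCube d :=
    ae_condPIT_mem_openCube (f := fun z => c (ψ β₀ (inner ℝ β₀ z)))
      (h_model.mono fun z hz => hz.2)
  have hθ_cont : ∀ u ∈ openCube d, ContinuousOn (fun t => Real.log (c t u)) Θ :=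
    fun u hu θ hθ => by
      obtain ⟨g, hg, -⟩ := h_grad u hu θ hθ
      exact hg.hasFDerivWithinAt.continuousWithinAt
  have hH : IntegrableOn (fun w => h (condPIT μ w, w.2)) {w | w.2 ∈ covBox p Mz} μ := by
    refine integrableOn_of_rpow measurableSet_snd_mem_covBox (measure_ne_top _ _) hα.le
      (hh_meas.comp ((measurable_condPIT μ).prodMk measurable_snd)).aestronglyMeasurable ?_ hh_int
    filter_upwards [h_env] with w hw hz using (abs_nonneg _).trans (hw hz β₀ hβ₀)
  have hψhat' : ∀ ε : ℝ, 0 < ε → HighProb P fun n ω => ∀ z ∈ covBox p Mz, ∀ b ∈ B,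
      ‖ψhat n ω b (inner ℝ b z) - ψ b (inner ℝ b z)‖ ≤ ε := fun ε hε => by
    refine HighProb.mono (E := fun n ω => ¬ ENNReal.ofReal ε <
      ⨆ z ∈ covBox p Mz, ⨆ b ∈ B,
        ENNReal.ofReal ‖ψhat n ω b (inner ℝ b z) - ψ b (inner ℝ b z)‖) ?_
      (Eventually.of_forall fun n => Eventually.of_forall fun ω hω z hz b hb => ?_)
    · simpa only [HighProb, not_not] using hψhat ε hε
    · refine (ENNReal.ofReal_le_ofReal_iff hε.le).1 (le_trans ?_ (not_lt.1 hω))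
      exact (le_iSup₂_of_le b hb le_rfl).trans (le_iSup₂_of_le (f := fun z (_ : z ∈ covBox p Mz) =>
        ⨆ b ∈ B, ENNReal.ofReal ‖ψhat n ω b (inner ℝ b z) - ψ b (inner ℝ b z)‖) z hz le_rfl)
  rw [tendstoInMeasure_iff_dist]
  intro ε hε
  have hclosed : IsClosed {b : Vec p | ε ≤ dist b β₀} :=
    isClosed_le continuous_const (continuous_id.dist continuous_const)
  obtain ⟨κ, hκ, hwald⟩ := exists_highProb_average_add_le h_indep h_law hB
    (G := oracleTerm μ c Mz ψ)
    (fun b hb => aestronglyMeasurable_oracleTerm hθ_cont (fun θ hθ => (hc θ hθ).continuousOn)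
      (hψ_meas b hb) (hψ_mem b hb) hU)
    (ae_continuousOn_oracleTerm h_cont) (ae_abs_oracleTerm_le h_env)
    (hH.integrable_indicator measurableSet_snd_mem_covBox) hβ₀
    (hB.inter_right hclosed) inter_subset_left (fun b hb => by
      have hne : b ≠ β₀ := by
        rintro rfl
        have := hb.2
        rw [mem_ofPred_eq, dist_self] at this
        linarith
      have hlt := hM_max b hb.1 hne
      rw [limitCriterion_eq_integral_oracleTerm, limitCriterion_eq_integral_oracleTerm] at hlt
      exact lt_of_mul_lt_mul_left hlt ENNReal.toReal_nonneg)
  have hrem := highProb_abs_criterion_sub_oracle_le h_indep h_law hU hΘ_paths hν hν_lim hψ_mem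
    hh_meas h_env hH hψhat_mem hψhat' hUhat_mem hδ_pos hδ
    (highProb_norm_pseudo_sub_le h_law hUhat_meas hδ_pos hUhat) hr h_grad hr_int hrt h_partial
    hrt_int (show 0 < κ / 3 by positivity)
  have hmain : HighProb P fun n ω => dist (βhat n ω) β₀ < ε := by
    refine (hwald.and hrem).mono (Eventually.of_forall fun n => ?_)
    filter_upwards [hβhat n] with ω hω hE
    by_contra hfar
    have h1 := hE.1 _ ⟨hω.1, not_lt.1 hfar⟩
    have h2 := abs_le.1 (hE.2 _ hω.1)
    have h3 := abs_le.1 (hE.2 _ hβ₀)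
    have h4 := div_le_div_of_nonneg_right (hω.2 β₀ hβ₀) (Nat.cast_nonneg (α := ℝ) n)
    linarith [h2.2, h3.1]
  simpa only [HighProb, not_lt] using hmain
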